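/- Let $S$ be a poset. Let $\operatorname{Op} S$ be the frame of upsets of $S$ ordered by inclusion (the open sets of $S$ viewed as an Alexandroff space), and let $N(\operatorname{Op} S)$ be the frame of nuclei of $\operatorname{Op} S$, ordered pointwise. Call a frame spatial if it is isomorphic to the frame of open sets of some topological space, and boolean if each of its elements has a complement. Call $S$ noetherian if it has no infinite ascending chain $s_0 < s_1 < s_2 < \cdots$. 1. If $S$ has no infinite antichains, then $N(\operatorname{Op} S)$ is spatial. 2. If $S$ is totally ordered, then $N(\operatorname{Op} S)$ is spatial. 3. Consequently, if $S$ has no infinite antichains (in particular, if $S$ is totally ordered) and $S$ is not noetherian, then $N(\operatorname{Op} S)$ is spatial but not boolean. -/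

import Mathlib

universe u

/-- A frame is *spatial* if it is isomorphic to the frame of open sets of some topological space.
The space may be taken in the universe of the frame, since the space of points of a frame lives
there. -/
def IsSpatialFrame (L : Type u) [Order.Frame L] : Prop :=
  ∃ (X : Type u) (_ : TopologicalSpace X), Nonempty (L ≃o TopologicalSpace.Opens X)

/-- A frame is *boolean* if, as a (bounded distributive) lattice, it is a boolean algebra, that is,
every element has a complement. -/
def IsBooleanFrame (L : Type u) [Order.Frame L] : Prop :=
  ∀ a : L, ∃ b : L, IsCompl a b

/-- The frame `Op S` of upsets of the poset `S`, ordered by inclusion: the open sets of `S` viewed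
as an Alexandroff space. (Mathlib's type `UpperSet S` carries the reverse order.) -/
abbrev OpFrame (S : Type u) [PartialOrder S] : Type u :=
  TopologicalSpace.Opens (Topology.WithUpperSet S)

/-- The poset `S` has no infinite antichains. -/
def NoInfiniteAntichains (S : Type u) [PartialOrder S] : Prop :=
  ∀ A : Set S, IsAntichain (· ≤ ·) A → A.Finite

/-- The poset `S` is totally ordered, that is, a chain. -/
def IsTotallyOrdered (S : Type u) [PartialOrder S] : Prop :=
  ∀ s t : S, s ≤ t ∨ t ≤ s

/-- The poset `S` is noetherian: there is no infinite ascending chain `s₀ < s₁ < s₂ < ⋯`. -/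
def IsNoetherianPoset (S : Type u) [PartialOrder S] : Prop :=
  ¬ ∃ s : ℕ → S, StrictMono s

open TopologicalSpace Topology

/-! A nucleus is determined by its fixed elements, so spatiality follows once every fixed upset is a
meet of fixed primes (`isSpatialFrame_nucleus_of_primes`). Without infinite antichains,
`exists_directed_above` supplies directed pieces of the complement, and these give such primes. An
ascending chain yields a nucleus without a complement (`exists_nucleus_forall_not_isCompl`); this
part needs no antichain condition. -/

/-- In a set `D` of a preorder without infinite antichains, every element `x` lies below
an element of `D` whose upper bounds in `D` are directed. -/
theorem exists_directed_above {T : Type*} [Preorder T]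
    (h : ∀ A : Set T, IsAntichain (· ≤ ·) A → A.Finite) (D : Set T) {x : T} (hx : x ∈ D) :
    ∃ y ∈ D, x ≤ y ∧ DirectedOn (· ≤ ·) (D ∩ Set.Ici y) := by
  by_contra hcon
  have key : ∀ y : {y // y ∈ D ∧ x ≤ y}, ∃ a b : {y // y ∈ D ∧ x ≤ y},
      y ≤ a ∧ y ≤ b ∧ ∀ c ∈ D, a.1 ≤ c → b.1 ≤ c → False := by
    rintro ⟨y, hyD, hxy⟩
    by_contra hno
    refine hcon ⟨y, hyD, hxy, ?_⟩
    rintro a ⟨haD, hya⟩ b ⟨hbD, hyb⟩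
    by_contra hc
    refine hno ⟨⟨a, haD, hxy.trans hya⟩, ⟨b, hbD, hxy.trans hyb⟩, hya, hyb, ?_⟩
    exact fun c hcD hac hbc => hc ⟨c, ⟨hcD, le_trans (Set.mem_Ici.1 hya) hac⟩, hac, hbc⟩
  choose l r hl hr hlr using key
  -- Climb along the right branches; the left branches `l (s n)` then form an infinite antichain.
  let s : ℕ → {y // y ∈ D ∧ x ≤ y} := fun n => r^[n] ⟨x, hx, le_rfl⟩
  have hs : ∀ n, s (n + 1) = r (s n) := fun n => Function.iterate_succ_apply' r n _
  have hmono : Monotone s := monotone_nat_of_le_succ fun n => by rw [hs]; exact hr _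
  have hbound : ∀ m n, m < n → ∀ c ∈ D, (l (s m)).1 ≤ c → (l (s n)).1 ≤ c → False := by
    intro m n hmn c hc hm hn
    refine hlr (s m) c hc hm (le_trans ?_ hn)
    rw [← hs]
    exact (hmono hmn).trans (hl _)
  have hne : ∀ m n, m ≠ n → ¬ (l (s m)).1 ≤ (l (s n)).1 := by
    intro m n hmn hle
    rcases hmn.lt_or_gt with hlt | hlt
    · exact hbound m n hlt _ (l (s n)).2.1 hle le_rfl
    · exact hbound n m hlt _ (l (s n)).2.1 le_rfl hle
  have hinj : Function.Injective fun n => (l (s n)).1 := fun m n hmn => by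
    by_contra hcon
    exact hne m n hcon (le_of_eq hmn)
  refine Set.infinite_range_of_injective hinj (h _ ?_)
  rintro _ ⟨m, rfl⟩ _ ⟨n, rfl⟩ hmn
  exact hne m n fun e => hmn (by rw [e])

namespace Nucleus

variable {L : Type*} [Order.Frame L]

/-- The largest nucleus fixing `p`, sending `a` to `(a ⇨ p) ⇨ p`. -/
def largestFixing (p : L) : Nucleus L where
  toFun a := (a ⇨ p) ⇨ p
  map_inf' a b := by
    refine le_antisymm (le_inf ?_ ?_) ?_
    · exact himp_le_himp_right (himp_le_himp_right inf_le_left)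
    · exact himp_le_himp_right (himp_le_himp_right inf_le_right)
    · rw [le_himp_iff]
      have h₁ : a ⊓ ((a ⊓ b) ⇨ p) ≤ b ⇨ p := by
        rw [le_himp_iff, inf_right_comm]
        exact inf_himp_le
      have h₂ : ((b ⇨ p) ⇨ p) ⊓ ((a ⊓ b) ⇨ p) ≤ a ⇨ p := by
        rw [le_himp_iff, inf_assoc, inf_comm _ a]
        exact (inf_le_inf_left _ h₁).trans himp_inf_le
      rw [inf_assoc]
      exact (inf_le_inf_left _ h₂).trans himp_inf_le
  idempotent' a := himp_le_himp_right le_himp_himp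
  le_apply' a := le_himp_himp

theorem largestFixing_apply (p a : L) : largestFixing p a = (a ⇨ p) ⇨ p := rfl

theorem largestFixing_self (p : L) : largestFixing p p = p := by
  simp [largestFixing_apply]

theorem le_largestFixing_iff {n : Nucleus L} {p : L} : n ≤ largestFixing p ↔ n p = p := by
  constructor
  · intro h
    exact le_antisymm ((h p).trans_eq (largestFixing_self p)) n.le_apply
  · intro h a
    show n a ≤ (a ⇨ p) ⇨ p
    rw [le_himp_iff]
    calc n a ⊓ (a ⇨ p) ≤ n a ⊓ n (a ⇨ p) := inf_le_inf_left _ n.le_apply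
      _ = n (a ⊓ (a ⇨ p)) := n.map_inf.symm
      _ ≤ n p := n.monotone inf_himp_le
      _ = p := h

/-- Fixing `p` means lying below `largestFixing p`, so no formula for suprema of nuclei is needed.
-/
theorem sSup_apply_eq_self_iff {s : Set (Nucleus L)} {p : L} :
    sSup s p = p ↔ ∀ n ∈ s, n p = p := by
  simp only [← le_largestFixing_iff, sSup_le_iff]

theorem apply_himp_eq_self {n : Nucleus L} {a : L} (h : n a = a) (b : L) :
    n (b ⇨ a) = b ⇨ a := by
  simpa only [h] using n.map_himp_apply b a

theorem inf_apply_eq_self_iff {m n : Nucleus L} {p : L} (hp : InfPrime p) :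
    (m ⊓ n) p = p ↔ m p = p ∨ n p = p := by
  constructor
  · intro h
    exact (hp.2 (inf_apply m n p ▸ h).le).imp
      (fun h => le_antisymm h m.le_apply) (fun h => le_antisymm h n.le_apply)
  · rintro (h | h)
    · rw [inf_apply, h, inf_eq_left]; exact n.le_apply
    · rw [inf_apply, h, inf_eq_right]; exact m.le_apply

end Nucleus

/-- If every element fixed by a nucleus is a meet of prime elements fixed by it, then the frame of
nuclei is spatial: its points are the primes, and `n` corresponds to the open set of the primes
which it does not fix. -/
theorem isSpatialFrame_nucleus_of_primes {L : Type u} [Order.Frame L]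
    (h : ∀ (n : Nucleus L) (a b : L), n a = a → ¬ b ≤ a →
      ∃ p, InfPrime p ∧ n p = p ∧ a ≤ p ∧ ¬ b ≤ p) :
    IsSpatialFrame (Nucleus L) := by
  let X := {p : L // InfPrime p}
  let U : Nucleus L → Set X := fun n => {p | n p.1 ≠ p.1}
  let τ : TopologicalSpace X :=
    { IsOpen := fun V => ∃ n, U n = V
      isOpen_univ := ⟨⊤, by
        ext p
        simpa [U] using p.2.ne_top.symm⟩
      isOpen_inter := by
        rintro _ _ ⟨m, rfl⟩ ⟨n, rfl⟩
        refine ⟨m ⊓ n, ?_⟩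
        ext p
        exact (not_congr (Nucleus.inf_apply_eq_self_iff p.2)).trans not_or
      isOpen_sUnion := by
        intro s hs
        refine ⟨sSup {n | U n ∈ s}, ?_⟩
        ext p
        simp only [U, Set.mem_ofPred_eq, Set.mem_sUnion, ne_eq, Nucleus.sSup_apply_eq_self_iff,
          not_forall]
        constructor
        · rintro ⟨n, hn, hp⟩
          exact ⟨_, hn, hp⟩
        · rintro ⟨V, hV, hp⟩
          obtain ⟨n, rfl⟩ := hs V hV
          exact ⟨n, hV, hp⟩ }
  have hle : ∀ m n : Nucleus L, U m ⊆ U n ↔ m ≤ n := by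
    intro m n
    constructor
    · intro hmn a
      by_contra hc
      obtain ⟨p, hp, hnp, hap, hmp⟩ := h n (n a) (m a) (n.idempotent a) hc
      refine hmp ?_
      have : m p = p := by
        by_contra hne
        exact hmn (show (⟨p, hp⟩ : X) ∈ U m from hne) hnp
      exact this ▸ m.monotone (n.le_apply.trans hap)
    · intro hmn p hp hnp
      exact hp (le_antisymm ((hmn p.1).trans_eq hnp) m.le_apply)
  let e : Nucleus L ↪o Opens X :=
    { toFun := fun n => ⟨U n, n, rfl⟩
      inj' := fun m n hmn => by
        have := congrArg (fun V : Opens X => (V : Set X)) hmn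
        exact le_antisymm ((hle m n).1 (Eq.subset this)) ((hle n m).1 (Eq.subset this.symm))
      map_rel_iff' := fun {m n} => hle m n }
  refine ⟨X, τ, ⟨RelIso.ofSurjective e ?_⟩⟩
  rintro ⟨V, n, rfl⟩
  exact ⟨n, rfl⟩

section UpperSetTopology

variable {T : Type*} [Preorder T] [TopologicalSpace T] [Topology.IsUpperSet T]

theorem mem_himp_iff_forall_ge {V W : Opens T} {s : T} :
    s ∈ V ⇨ W ↔ ∀ t, s ≤ t → t ∈ V → t ∈ W := by
  rw [Opens.mem_himp]
  constructor
  · rintro ⟨O, hO, hs⟩ t hst ht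
    exact hO ⟨Topology.IsUpperSet.isOpen_iff_isUpperSet.1 O.2 hst hs, ht⟩
  · intro h
    exact ⟨⟨Set.Ici s, Topology.IsUpperSet.isOpen_iff_isUpperSet.2 (isUpperSet_Ici s)⟩,
      fun t ht => h t ht.1 ht.2, Set.self_mem_Ici⟩

/-- The complement of a directed lower set is prime. -/
theorem infPrime_of_directedOn_compl {P : Opens T} (hne : ((P : Set T)ᶜ).Nonempty)
    (hd : DirectedOn (· ≤ ·) (P : Set T)ᶜ) : InfPrime P := by
  obtain ⟨x, hx⟩ := hne
  refine ⟨fun hmax => hx (hmax (le_top : P ≤ ⊤) (Opens.mem_top x)), fun V W hVW => ?_⟩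
  by_contra! hc
  obtain ⟨v, hvV, hvP⟩ := Set.not_subset.1 hc.1
  obtain ⟨w, hwW, hwP⟩ := Set.not_subset.1 hc.2
  obtain ⟨z, hz, hvz, hwz⟩ := hd v hvP w hwP
  exact hz (hVW ⟨Topology.IsUpperSet.isOpen_iff_isUpperSet.1 V.2 hvz hvV,
    Topology.IsUpperSet.isOpen_iff_isUpperSet.1 W.2 hwz hwW⟩)

theorem exists_infPrime_fixed (h : ∀ A : Set T, IsAntichain (· ≤ ·) A → A.Finite)
    (n : Nucleus (Opens T)) (U V : Opens T) (hU : n U = U) (hVU : ¬ V ≤ U) :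
    ∃ P, InfPrime P ∧ n P = P ∧ U ≤ P ∧ ¬ V ≤ P := by
  obtain ⟨x, hxV, hxU⟩ := Set.not_subset.1 hVU
  obtain ⟨y, hyU, hxy, hy⟩ := exists_directed_above h (U : Set T)ᶜ hxU
  -- The prime is `Y ⇨ U`: its complement is the lower closure of the directed set `Uᶜ ∩ Set.Ici y`,
  -- and `n` fixes it because it fixes `U`.
  let Y : Opens T := ⟨Set.Ici y, Topology.IsUpperSet.isOpen_iff_isUpperSet.2 (isUpperSet_Ici y)⟩
  have hmem : ∀ s, s ∉ Y ⇨ U ↔ ∃ t, s ≤ t ∧ y ≤ t ∧ t ∉ U := by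
    intro s
    rw [mem_himp_iff_forall_ge]
    push Not
    exact Iff.rfl
  have hx : x ∉ Y ⇨ U := (hmem x).2 ⟨y, hxy, le_rfl, hyU⟩
  refine ⟨Y ⇨ U, infPrime_of_directedOn_compl ⟨x, hx⟩ ?_, n.apply_himp_eq_self hU Y, le_himp,
    fun hV => hx (hV hxV)⟩
  intro a ha b hb
  obtain ⟨a', haa', hya', ha'⟩ := (hmem a).1 ha
  obtain ⟨b', hbb', hyb', hb'⟩ := (hmem b).1 hb
  obtain ⟨c, ⟨hcU, hyc⟩, hac, hbc⟩ := hy a' ⟨ha', hya'⟩ b' ⟨hb', hyb'⟩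
  exact ⟨c, (hmem c).2 ⟨c, le_rfl, hyc, hcU⟩, haa'.trans hac, hbb'.trans hbc⟩

/-- If `s` is strictly increasing and `P` is the complement of the lower closure of its range, then
the largest nucleus fixing `P` has no complement. -/
theorem exists_nucleus_forall_not_isCompl {s : ℕ → T} (hs : StrictMono s) :
    ∃ m : Nucleus (Opens T), ∀ n, ¬ IsCompl m n := by
  let P : Opens T := ⟨{t | ∀ i, ¬ t ≤ s i}, Topology.IsUpperSet.isOpen_iff_isUpperSet.2
    fun a b hab ha i hb => ha i (hab.trans hb)⟩
  refine ⟨Nucleus.largestFixing P, fun n hn => ?_⟩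
  have hnP : n P ≠ P := by
    intro h
    have htop : (⊤ : Nucleus (Opens T)) ≤ Nucleus.largestFixing P := by
      rw [← hn.sup_eq_top]
      exact sup_le le_rfl (Nucleus.le_largestFixing_iff.2 h)
    have hP : (⊤ : Opens T) = P := Nucleus.le_largestFixing_iff.1 htop
    have h0 : s 0 ∈ P := hP ▸ Opens.mem_top _
    exact h0 0 le_rfl
  obtain ⟨t, htn, htP⟩ := Set.not_subset.1 fun h : (n P : Set T) ⊆ P =>
    hnP (le_antisymm h n.le_apply)
  obtain ⟨i, hti⟩ : ∃ i, t ≤ s i := by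
    by_contra! hc
    exact htP hc
  -- `A` contains `P` but not `t`. The chain continues past `s i`, so `largestFixing P` sends `A` to
  -- `⊤`; a complement `n` must then fix `A`, contradicting `t ∈ n P`.
  let A : Opens T := ⟨{t | ¬ t ≤ s i}, Topology.IsUpperSet.isOpen_iff_isUpperSet.2
    fun a b hab ha hb => ha (hab.trans hb)⟩
  have hA : Nucleus.largestFixing P A = ⊤ := by
    rw [Nucleus.largestFixing_apply, himp_eq_top_iff]
    intro a ha j haj
    -- The index is at least `j` to stay above `a`, and beyond `i` to land in `A`.
    have hk : i < max j (i + 1) := lt_of_lt_of_le (Nat.lt_succ_self i) (le_max_right _ _)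
    exact mem_himp_iff_forall_ge.1 ha (s (max j (i + 1)))
      (haj.trans (hs.monotone (le_max_left _ _))) (hs hk).not_ge _ le_rfl
  have hnA : n A = A := by
    have := congrArg (fun k : Nucleus (Opens T) => k A) hn.inf_eq_bot
    simpa [hA] using this
  have hPA : P ≤ A := fun a ha => ha i
  have htA : t ∈ A := hnA ▸ n.monotone hPA htn
  exact htA hti

end UpperSetTopology

theorem NoInfiniteAntichains.isSpatialFrame {S : Type u} [PartialOrder S]
    (h : NoInfiniteAntichains S) : IsSpatialFrame (Nucleus (OpFrame S)) :=
  isSpatialFrame_nucleus_of_primes fun n U V =>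
    exists_infPrime_fixed (T := WithUpperSet S) h n U V

theorem IsTotallyOrdered.noInfiniteAntichains {S : Type u} [PartialOrder S]
    (h : IsTotallyOrdered S) : NoInfiniteAntichains S := by
  intro A hA
  refine Set.Subsingleton.finite fun a ha b hb => ?_
  rcases h a b with hab | hba
  · exact hA.eq ha hb hab
  · exact (hA.eq hb ha hba).symm

theorem not_isBooleanFrame_of_not_isNoetherianPoset {S : Type u} [PartialOrder S]
    (h : ¬ IsNoetherianPoset S) : ¬ IsBooleanFrame (Nucleus (OpFrame S)) := by
  intro hb
  obtain ⟨s, hs⟩ := not_not.1 h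
  obtain ⟨m, hm⟩ := exists_nucleus_forall_not_isCompl (T := WithUpperSet S) (s := s) hs
  obtain ⟨n, hn⟩ := hb m
  exact hm n hn

theorem corollary4p2 (S : Type u) [PartialOrder S] :
    (NoInfiniteAntichains S → IsSpatialFrame (Nucleus (OpFrame S))) ∧
    (IsTotallyOrdered S → IsSpatialFrame (Nucleus (OpFrame S))) ∧
    (NoInfiniteAntichains S → ¬ IsNoetherianPoset S →
      IsSpatialFrame (Nucleus (OpFrame S)) ∧ ¬ IsBooleanFrame (Nucleus (OpFrame S))) ∧
    (IsTotallyOrdered S → ¬ IsNoetherianPoset S →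
      IsSpatialFrame (Nucleus (OpFrame S)) ∧ ¬ IsBooleanFrame (Nucleus (OpFrame S))) :=
  ⟨fun h => h.isSpatialFrame, fun h => h.noInfiniteAntichains.isSpatialFrame,
    fun h hn => ⟨h.isSpatialFrame, not_isBooleanFrame_of_not_isNoetherianPoset hn⟩,
    fun h hn => ⟨h.noInfiniteAntichains.isSpatialFrame,
      not_isBooleanFrame_of_not_isNoetherianPoset hn⟩⟩
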